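/- Let $k$ be an algebraically closed field of characteristic $p \geq 3$ and let $\mathfrak g = \mathfrak g_{\bar 0} \oplus \mathfrak g_{\bar 1}$ be a finite-dimensional Lie superalgebra over $k$ (if $p = 3$, the identity $[x,[x,x]] = 0$ for odd $x$ is part of the definition). Let $\Lambda_s(\mathfrak g^*) \cong \Lambda(\mathfrak g_{\bar 0}^*) \otimes S(\mathfrak g_{\bar 1}^*)$ be the superexterior algebra, that is, the free graded-commutative graded superalgebra generated by the superspace $\mathfrak g^*$ in cohomological degree $1$, so that $ab = (-1)^{\bar a \bar b + \deg(a)\deg(b)} ba$. For a finite-dimensional $\mathfrak g$-supermodule $V$ let $\mathrm H^\bullet(\mathfrak g, V)$ be the cohomology of the Koszul complex $\Lambda_s(\mathfrak g^*) \otimes V$, whose differential is determined by the bracket of $\mathfrak g$ and the action on $V$. Then $\mathrm H^\bullet(\mathfrak g,k)$ is a graded-commutative superalgebra. For finite-dimensional $\mathfrak g$-supermodules $M$ and $N$ it acts by the cup product on $\mathrm{Ext}^\bullet_{\mathfrak g}(M,N) = \mathrm H^\bullet(\mathfrak g, \mathrm{Hom}_k(M,N))$; let $I_{\mathfrak g}(M,N)$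 be the annihilator ideal of this action. For a graded-commutative superalgebra $A$ let $\mathrm{Max}(A)$ be the maximal ideal spectrum, with the Zariski topology, of the commutative ring $A/\mathrm{Nil}(A)$, where $\mathrm{Nil}(A)$ is the ideal of nilpotent elements. The relative support variety is $|U(\mathfrak g)|_{(M,N)} = \mathrm{Max}\big(\mathrm H^\bullet(\mathfrak g,k)/I_{\mathfrak g}(M,N)\big)$. Let $S(\mathfrak g_{\bar 1}^*[p])^{(1)}$ be the symmetric algebra on $\mathfrak g_{\bar 1}^*$ placed in degree $p$, with scalars twisted by the Frobenius map. The $p$-power map $z \mapsto z^p$ from $S(\mathfrak g_{\bar 1}^*)$ to $S(\mathfrak g_{\bar 1}^*) \subseteq \Lambda_s(\mathfrak g^*)$ takes values in the cocycles of the Koszul complex, and so induces a homomorphism $$\varphi : S(\mathfrak g_{\bar 1}^*[p])^{(1)} \to \mathrm H^\bullet(\mathfrak g,k).$$ Set $J_{\mathfrak g}(M,N) = \varphi^{-1}(I_{\mathfrak g}(M,N))$ and $\mathcal X_{\mathfrak g}(M,N) = \mathrm{Max}\big(S(\mathfrak g_{\bar 1}^*[p])^{(1)}/J_{\mathfrak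 g}(M,N)\big)$, and let $\varphi_{M,N} : S(\mathfrak g_{\bar 1}^*[p])^{(1)}/J_{\mathfrak g}(M,N) \to \mathrm H^\bullet(\mathfrak g,k)/I_{\mathfrak g}(M,N)$ be the homomorphism induced by $\varphi$. Then for each pair of finite-dimensional $\mathfrak g$-supermodules $M$ and $N$ the homomorphism $\varphi$ induces a homeomorphism $$\varphi_{M,N}^* : |U(\mathfrak g)|_{(M,N)} \xrightarrow{\ \sim\ } \mathcal X_{\mathfrak g}(M,N), \qquad \mathfrak m \mapsto \varphi_{M,N}^{-1}(\mathfrak m).$$ -/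

import Mathlib

noncomputable section

/-- A superspace over `k`: a vector space with a decomposition `V = part 0 ⊕ part 1`
into its even and its odd subspace. -/
class Superspace (k V : Type*) [Field k] [AddCommGroup V] [Module k V] where
  part : ZMod 2 → Submodule k V
  isCompl : IsCompl (part 0) (part 1)

/-- The homogeneous subspace of parity `a` of a superspace. -/
abbrev superPart (k : Type*) {V : Type*} [Field k] [AddCommGroup V] [Module k V] [Superspace k V]
    (a : ZMod 2) : Submodule k V :=
  Superspace.part a

/-- The sign `(-1)^{ab}` for parities `a` and `b`. -/
def superSign (a b : ZMod 2) : ℤ := (-1) ^ (a.val * b.val)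

/-- The projection of a superspace onto its even subspace. -/
def evenProj (k : Type*) {V : Type*} [Field k] [AddCommGroup V] [Module k V] [Superspace k V] :
    V →ₗ[k] V :=
  Submodule.projection (superPart k 0) (superPart k 1) Superspace.isCompl

/-- The projection of a superspace onto its odd subspace. -/
def oddProj (k : Type*) {V : Type*} [Field k] [AddCommGroup V] [Module k V] [Superspace k V] :
    V →ₗ[k] V :=
  Submodule.projection (superPart k 1) (superPart k 0) Superspace.isCompl.symm

/-- The parity involution: `v ↦ v` for even `v` and `v ↦ -v` for odd `v`. -/
def parityInv (k : Type*) {V : Type*} [Field k] [AddCommGroup V] [Module k V] [Superspace k V] :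
    V →ₗ[k] V :=
  evenProj k - oddProj k

/-- Lie superalgebras over `k` (a field of characteristic `≠ 2`). The last axiom follows from the
super Jacobi identity except in characteristic `3`, where it is part of the usual definition. -/
class LieSuperalgebra (k L : Type*) [Field k] [AddCommGroup L] [Module k L]
    [Superspace k L] where
  bracket : L →ₗ[k] L →ₗ[k] L
  bracket_mem : ∀ (a b : ZMod 2) (x y : L), x ∈ superPart k a → y ∈ superPart k b →
    bracket x y ∈ superPart k (a + b)
  skew : ∀ (a b : ZMod 2) (x y : L), x ∈ superPart k a → y ∈ superPart k b →
    bracket x y = -(superSign a b • bracket y x)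
  jacobi : ∀ (a b : ZMod 2) (x y z : L), x ∈ superPart k a → y ∈ superPart k b →
    bracket x (bracket y z) = bracket (bracket x y) z + superSign a b • bracket y (bracket x z)
  odd_cube : ∀ x : L, x ∈ superPart k 1 → bracket x (bracket x x) = 0

/-- The bracket of a Lie superalgebra. -/
abbrev superBracket (k : Type*) {L : Type*} [Field k] [AddCommGroup L] [Module k L]
    [Superspace k L] [LieSuperalgebra k L] : L →ₗ[k] L →ₗ[k] L :=
  LieSuperalgebra.bracket

/-- Supermodules over a Lie superalgebra `L` (that is, over its universal enveloping
superalgebra). -/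
class LieSupermodule (k L V : Type*) [Field k] [AddCommGroup L] [Module k L] [Superspace k L]
    [LieSuperalgebra k L] [AddCommGroup V] [Module k V] [Superspace k V] where
  act : L →ₗ[k] Module.End k V
  act_mem : ∀ (a b : ZMod 2) (x : L) (v : V), x ∈ superPart k a → v ∈ superPart k b →
    act x v ∈ superPart k (a + b)
  act_bracket : ∀ (a b : ZMod 2) (x y : L) (v : V), x ∈ superPart k a → y ∈ superPart k b →
    act (superBracket k x y) v = act x (act y v) - superSign a b • act y (act x v)

/-- The action of a Lie superalgebra on a supermodule. -/
abbrev superAct (k : Type*) {L V : Type*} [Field k] [AddCommGroup L] [Module k L] [Superspace k L]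
    [LieSuperalgebra k L] [AddCommGroup V] [Module k V] [Superspace k V] [LieSupermodule k L V] :
    L →ₗ[k] Module.End k V :=
  LieSupermodule.act

section Superspace

variable {k : Type*} [Field k] {V W : Type*} [AddCommGroup V] [Module k V] [Superspace k V]
  [AddCommGroup W] [Module k W] [Superspace k W]

lemma evenProj_mem (v : V) : evenProj k v ∈ superPart k (V := V) 0 :=
  Submodule.projection_apply_mem _ _

lemma oddProj_mem (v : V) : oddProj k v ∈ superPart k (V := V) 1 :=
  Submodule.projection_apply_mem _ _

lemma evenProj_add_oddProj (v : V) : evenProj k v + oddProj k v = v :=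
  Submodule.projection_add_projection_eq_self _ _

lemma evenProj_of_even {v : V} (h : v ∈ superPart k 0) : evenProj k v = v :=
  Submodule.projection_apply_of_mem_left _ h

lemma evenProj_of_odd {v : V} (h : v ∈ superPart k 1) : evenProj k v = 0 :=
  Submodule.projection_apply_of_mem_right _ h

lemma oddProj_of_odd {v : V} (h : v ∈ superPart k 1) : oddProj k v = v :=
  Submodule.projection_apply_of_mem_left _ h

lemma oddProj_of_even {v : V} (h : v ∈ superPart k 0) : oddProj k v = 0 :=
  Submodule.projection_apply_of_mem_right _ h

lemma parityInv_of_even {v : V} (h : v ∈ superPart k 0) : parityInv k v = v := by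
  simp [parityInv, evenProj_of_even h, oddProj_of_even h]

lemma parityInv_of_odd {v : V} (h : v ∈ superPart k 1) : parityInv k v = -v := by
  simp [parityInv, evenProj_of_odd h, oddProj_of_odd h]

lemma zmod_two_cases (a : ZMod 2) : a = 0 ∨ a = 1 := by
  revert a; decide

lemma parityInv_of_mem (a : ZMod 2) {v : V} (h : v ∈ superPart k a) :
    parityInv k v = superSign 1 a • v := by
  rcases zmod_two_cases a with rfl | rfl
  · simp [parityInv_of_even h, superSign]
  · simp [parityInv_of_odd h, superSign, ZMod.val_one]

lemma superspace_hom_ext {U : Type*} [AddCommGroup U] [Module k U] {f g : V →ₗ[k] U}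
    (h : ∀ (a : ZMod 2) (v : V), v ∈ superPart k a → f v = g v) : f = g := by
  ext v
  rw [← evenProj_add_oddProj (k := k) v, map_add, map_add, h 0 _ (evenProj_mem v),
    h 1 _ (oddProj_mem v)]

/-- The ground field as a purely even superspace. -/
instance superspaceField : Superspace k k where
  part a := if a = 0 then ⊤ else ⊥
  isCompl := by simpa using isCompl_top_bot

/-- `Hom_k(V, W)` as a superspace: a map has parity `a` if it shifts parities by `a`. -/
instance superspaceHom : Superspace k (V →ₗ[k] W) where
  part a :=
    { carrier := {f | ∀ (b : ZMod 2) (v : V), v ∈ superPart k b → f v ∈ superPart k (a + b)}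
      add_mem' := fun hf hg b v hv => add_mem (hf b v hv) (hg b v hv)
      zero_mem' := fun b v _ => zero_mem _
      smul_mem' := fun c f hf b v hv => Submodule.smul_mem _ c (hf b v hv) }
  isCompl := by
    have h11 : (1 + 1 : ZMod 2) = 0 := by decide
    constructor
    · rw [Submodule.disjoint_def]
      intro f hf hg
      refine superspace_hom_ext fun a v hv => ?_
      have h0 := hf a v hv
      have h1 := hg a v hv
      have hd := Submodule.disjoint_def.1 (Superspace.isCompl (k := k) (V := W)).disjoint
      rcases zmod_two_cases a with rfl | rfl
      · exact hd _ (by simpa using h0) (by simpa using h1)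
      · exact hd _ (by simpa [h11] using h1) (by simpa using h0)
    · rw [codisjoint_iff, eq_top_iff]
      intro f _
      rw [Submodule.mem_sup]
      refine ⟨evenProj k ∘ₗ f ∘ₗ evenProj k + oddProj k ∘ₗ f ∘ₗ oddProj k, ?_,
        oddProj k ∘ₗ f ∘ₗ evenProj k + evenProj k ∘ₗ f ∘ₗ oddProj k, ?_, ?_⟩
      · intro b v hv
        rcases zmod_two_cases b with rfl | rfl
        · simpa [oddProj_of_even hv] using evenProj_mem (k := k) (f (evenProj k v))
        · simpa [evenProj_of_odd hv] using oddProj_mem (k := k) (f (oddProj k v))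
      · intro b v hv
        rcases zmod_two_cases b with rfl | rfl
        · simpa [oddProj_of_even hv] using oddProj_mem (k := k) (f (evenProj k v))
        · simpa [evenProj_of_odd hv, h11] using evenProj_mem (k := k) (f (oddProj k v))
      · refine superspace_hom_ext fun a v hv => ?_
        rcases zmod_two_cases a with rfl | rfl
        · simp [oddProj_of_even hv, evenProj_of_even hv, evenProj_add_oddProj]
        · simp only [LinearMap.add_apply, LinearMap.comp_apply, oddProj_of_odd hv,
            evenProj_of_odd hv, map_zero, zero_add]
          rw [add_comm, evenProj_add_oddProj]

end Superspace

section Hom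

variable {k L : Type*} [Field k] [AddCommGroup L] [Module k L] [Superspace k L]
  [LieSuperalgebra k L] (M N : Type*) [AddCommGroup M] [Module k M] [Superspace k M]
  [LieSupermodule k L M] [AddCommGroup N] [Module k N] [Superspace k N] [LieSupermodule k L N]

/-- The action of `L` on `Hom_k(M, N)`, namely `(x.f)(m) = x.f(m) - (-1)^{|x||f|} f(x.m)`. For odd
`x` the sign `(-1)^{|f|}` is produced by conjugating `f` with the parity involutions. -/
def homAct : L →ₗ[k] Module.End k (M →ₗ[k] N) :=
  LinearMap.mk₂ k (fun (x : L) (f : M →ₗ[k] N) =>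
    superAct k x ∘ₗ f - f ∘ₗ superAct k (evenProj k x)
      - parityInv k ∘ₗ f ∘ₗ parityInv k ∘ₗ superAct k (oddProj k x))
    (fun x y f => by ext m; simp; abel)
    (fun c x f => by ext m; simp [smul_sub])
    (fun x f g => by ext m; simp; abel)
    (fun c x f => by ext m; simp [smul_sub])

variable {M N}

lemma parity_conj (a b : ZMod 2) {f : M →ₗ[k] N} (hf : f ∈ superPart k a) {m : M}
    (hm : m ∈ superPart k b) : parityInv k (f (parityInv k m)) = superSign 1 a • f m := by
  rw [parityInv_of_mem b hm, map_zsmul, map_zsmul, parityInv_of_mem (a + b) (hf b m hm), smul_smul]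
  congr 1
  clear hm hf
  revert a b; decide

lemma homAct_apply (a b : ZMod 2) {x : L} {f : M →ₗ[k] N} (hx : x ∈ superPart k a)
    (hf : f ∈ superPart k b) (m : M) :
    homAct M N x f m = superAct k x (f m) - superSign a b • f (superAct k x m) := by
  have key : (parityInv k ∘ₗ f ∘ₗ parityInv k : M →ₗ[k] N) = superSign 1 b • f := by
    refine superspace_hom_ext fun c v hv => ?_
    simpa using parity_conj b c hf hv
  have key' (v : M) : parityInv k (f (parityInv k v)) = superSign 1 b • f v :=
    LinearMap.congr_fun key v
  rcases zmod_two_cases a with rfl | rfl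
  · simp [homAct, evenProj_of_even hx, oddProj_of_even hx, superSign]
  · simp [homAct, evenProj_of_odd hx, oddProj_of_odd hx, key']

lemma homAct_mem (a b : ZMod 2) {x : L} {f : M →ₗ[k] N} (hx : x ∈ superPart k a)
    (hf : f ∈ superPart k b) : homAct M N x f ∈ superPart k (a + b) := by
  intro c m hm
  rw [homAct_apply a b hx hf]
  refine sub_mem ?_ (zsmul_mem ?_ _)
  · rw [add_assoc]
    exact LieSupermodule.act_mem _ _ _ _ hx (hf c m hm)
  · rw [add_comm a b, add_assoc]
    exact hf _ _ (LieSupermodule.act_mem _ _ _ _ hx hm)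

/-- The supermodule `Hom_k(M, N)`. -/
instance lieSupermoduleHom : LieSupermodule k L (M →ₗ[k] N) where
  act := homAct M N
  act_mem a b x f hx hf := homAct_mem a b hx hf
  act_bracket a b x y f hx hy := by
    have main : ∀ (c : ZMod 2) (f : M →ₗ[k] N), f ∈ superPart k c →
        homAct M N (superBracket k x y) f
          = homAct M N x (homAct M N y f) - superSign a b • homAct M N y (homAct M N x f) := by
      intro c f hf
      ext m
      rw [homAct_apply (a + b) c (LieSuperalgebra.bracket_mem a b x y hx hy) hf]
      rw [LinearMap.sub_apply, LinearMap.smul_apply,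
        homAct_apply a (b + c) hx (homAct_mem b c hy hf),
        homAct_apply b (a + c) hy (homAct_mem a c hx hf)]
      simp only [homAct_apply a c hx hf, homAct_apply b c hy hf,
        LieSupermodule.act_bracket a b x y _ hx hy, map_sub, map_zsmul]
      generalize superAct k x (superAct k y (f m)) = A1
      generalize superAct k y (superAct k x (f m)) = A2
      generalize superAct k x (f (superAct k y m)) = A3
      generalize superAct k y (f (superAct k x m)) = A4
      generalize f (superAct k x (superAct k y m)) = A5
      generalize f (superAct k y (superAct k x m)) = A6
      rcases zmod_two_cases a with rfl | rfl <;> rcases zmod_two_cases b with rfl | rfl <;>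
        rcases zmod_two_cases c with rfl | rfl <;>
        simp [superSign, ZMod.val_one, show (1 + 1 : ZMod 2) = 0 from by decide] <;> abel
    have e : f = evenProj k f + oddProj k f := (evenProj_add_oddProj f).symm
    rw [e]
    simp only [map_add, main 0 _ (evenProj_mem f), main 1 _ (oddProj_mem f), smul_add]
    abel

end Hom

section Koszul

variable (k L : Type*) [Field k] [AddCommGroup L] [Module k L] [Superspace k L]

/-- The relations `f h = (-1)^{|f||h| + 1} h f` for homogeneous `f, h` in the dual of `L`. -/
inductive SuperExteriorRel :
    TensorAlgebra k (Module.Dual k L) → TensorAlgebra k (Module.Dual k L) → Prop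
  | swap (a b : ZMod 2) (f h : Module.Dual k L) (hf : f ∈ superPart k a)
      (hh : h ∈ superPart k b) : SuperExteriorRel
        (TensorAlgebra.ι k f * TensorAlgebra.ι k h)
        (-(superSign a b • (TensorAlgebra.ι k h * TensorAlgebra.ι k f)))

/-- The superexterior algebra `Λ_s(L^*)`: the free graded-commutative graded superalgebra generated
by the superspace `L^*` in cohomological degree `1`. It is isomorphic to
`Λ(L_0^*) ⊗ S(L_1^*)`. -/
def SuperExterior : Type _ := RingQuot (SuperExteriorRel k L)

namespace SuperExterior

instance instRing : Ring (SuperExterior k L) :=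
  inferInstanceAs (Ring (RingQuot (SuperExteriorRel k L)))

instance instAlgebra : Algebra k (SuperExterior k L) :=
  inferInstanceAs (Algebra k (RingQuot (SuperExteriorRel k L)))

/-- The quotient map from the tensor algebra. -/
def mk : TensorAlgebra k (Module.Dual k L) →ₐ[k] SuperExterior k L :=
  RingQuot.mkAlgHom k (SuperExteriorRel k L)

variable {L}

/-- The inclusion of the generators `L^* → Λ_s(L^*)`. -/
def gen : Module.Dual k L →ₗ[k] SuperExterior k L :=
  (mk k L).toLinearMap ∘ₗ TensorAlgebra.ι k

variable {k}

lemma gen_swap (a b : ZMod 2) {f h : Module.Dual k L} (hf : f ∈ superPart k a)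
    (hh : h ∈ superPart k b) :
    gen k f * gen k h = -(superSign a b • (gen k h * gen k f)) := by
  have : mk k L (TensorAlgebra.ι k f * TensorAlgebra.ι k h)
      = mk k L (-(superSign a b • (TensorAlgebra.ι k h * TensorAlgebra.ι k f))) :=
    RingQuot.mkAlgHom_rel k (SuperExteriorRel.swap a b f h hf hh)
  simpa [gen, -zsmul_eq_mul] using this

/-- The universal property of `Λ_s(L^*)`. -/
def lift {A : Type*} [Ring A] [Algebra k A] (F : Module.Dual k L →ₗ[k] A)
    (hF : ∀ (a b : ZMod 2) (f h : Module.Dual k L), f ∈ superPart k a → h ∈ superPart k b →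
      F f * F h = -(superSign a b • (F h * F f))) : SuperExterior k L →ₐ[k] A :=
  RingQuot.liftAlgHom k ⟨TensorAlgebra.lift k F, by
    rintro _ _ ⟨a, b, f, h, hf, hh⟩
    simpa using hF a b f h hf hh⟩

lemma lift_gen {A : Type*} [Ring A] [Algebra k A] (F : Module.Dual k L →ₗ[k] A)
    (hF : ∀ (a b : ZMod 2) (f h : Module.Dual k L), f ∈ superPart k a → h ∈ superPart k b →
      F f * F h = -(superSign a b • (F h * F f))) (f : Module.Dual k L) :
    lift F hF (gen k f) = F f := by
  have : lift F hF (mk k L (TensorAlgebra.ι k f)) = TensorAlgebra.lift k F (TensorAlgebra.ι k f) :=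
    RingQuot.liftAlgHom_mkAlgHom_apply ..
  simpa [gen] using this

lemma induction {P : SuperExterior k L → Prop}
    (hs : ∀ c : k, P (algebraMap k _ c)) (hg : ∀ f, P (gen k f))
    (hm : ∀ x y, P x → P y → P (x * y)) (ha : ∀ x y, P x → P y → P (x + y))
    (z : SuperExterior k L) : P z := by
  obtain ⟨t, rfl⟩ : ∃ t, mk k L t = z := RingQuot.mkAlgHom_surjective k (SuperExteriorRel k L) z
  induction t using TensorAlgebra.induction with
  | algebraMap r => rw [AlgHom.commutes]; exact hs r
  | ι x => exact hg x
  | mul x y hx hy => rw [map_mul]; exact hm _ _ hx hy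
  | add x y hx hy => rw [map_add]; exact ha _ _ hx hy

/-- The sign `z ↦ (-1)^{deg z} z` given by the cohomological degree. -/
def gradeInv : SuperExterior k L →ₐ[k] SuperExterior k L :=
  lift (-(gen k : Module.Dual k L →ₗ[k] SuperExterior k L)) (fun a b f h hf hh => by
    rw [LinearMap.neg_apply, LinearMap.neg_apply, neg_mul_neg, neg_mul_neg]
    exact gen_swap a b hf hh)

@[simp]
lemma gradeInv_gen (f : Module.Dual k L) : gradeInv (gen k f) = -gen k f := by
  simp [gradeInv, lift_gen]

@[simp]
lemma gradeInv_gradeInv (z : SuperExterior k L) : gradeInv (gradeInv z) = z := by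
  induction z using SuperExterior.induction with
  | hs c => simp
  | hg f => simp
  | hm x y hx hy => simp [hx, hy]
  | ha x y hx hy => simp [hx, hy]

end SuperExterior

/-- A homogeneous basis of a finite-dimensional superspace. -/
def homBasis [FiniteDimensional k L] :
    Module.Basis (Fin (Module.finrank k (superPart k (V := L) 0)) ⊕
      Fin (Module.finrank k (superPart k (V := L) 1))) k L :=
  ((Module.finBasis k (superPart k (V := L) 0)).prod
    (Module.finBasis k (superPart k (V := L) 1))).map
      (Submodule.prodEquivOfIsCompl _ _ Superspace.isCompl)

variable {k L}

/-- The parity of the members of `homBasis`. -/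
def basisParity {m n : ℕ} : Fin m ⊕ Fin n → ZMod 2 :=
  Sum.elim (fun _ => 0) (fun _ => 1)

lemma homBasis_mem [FiniteDimensional k L] (i) :
    homBasis k L i ∈ superPart k (basisParity i) := by
  rcases i with i | i <;> simp [homBasis, basisParity]

lemma coord_eq_zero [FiniteDimensional k L] (i) {b : ZMod 2} (hb : b ≠ basisParity i) {v : L}
    (hv : v ∈ superPart k b) : (homBasis k L).coord i v = 0 := by
  rcases i with i | i <;> rcases zmod_two_cases b with rfl | rfl
  · exact absurd rfl hb
  · simp only [homBasis, Module.Basis.coord_apply, Module.Basis.map_repr, LinearEquiv.trans_apply,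
      Module.Basis.prod_repr_inl]
    rw [(Submodule.prodEquivOfIsCompl_symm_apply_fst_eq_zero _ _ _).2 hv]
    simp
  · simp only [homBasis, Module.Basis.coord_apply, Module.Basis.map_repr, LinearEquiv.trans_apply,
      Module.Basis.prod_repr_inr]
    rw [(Submodule.prodEquivOfIsCompl_symm_apply_snd_eq_zero _ _ _).2 hv]
    simp
  · exact absurd rfl hb

lemma mem_part_field {a : ZMod 2} {c : k} (h : a ≠ 0 → c = 0) : c ∈ superPart k (V := k) a := by
  change c ∈ (if a = 0 then ⊤ else ⊥ : Submodule k k)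
  by_cases ha : a = 0
  · simp [ha]
  · simp [h ha]

lemma eq_zero_of_mem_part_field {a : ZMod 2} {c : k} (h : c ∈ superPart k (V := k) a)
    (ha : a ≠ 0) : c = 0 := by
  change c ∈ (if a = 0 then ⊤ else ⊥ : Submodule k k) at h
  simpa [ha] using h

lemma coord_mem [FiniteDimensional k L] (i) :
    (homBasis k L).coord i ∈ superPart k (V := Module.Dual k L) (basisParity i) := by
  intro b v hv
  refine mem_part_field fun h => coord_eq_zero i (fun hb => h ?_) hv
  rw [hb]
  exact CharTwo.add_self_eq_zero _

/-! ### The Koszul differential -/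

variable [FiniteDimensional k L] [LieSuperalgebra k L]

open SuperExterior

/-- The Koszul differential on generators, `L^* → Λ_s²(L^*)`. It is the transpose of the bracket:
for a basis `e_i` of `L` with dual basis `f_i` (the result does not depend on this basis),
`∂ f = ½ ∑_{i,j} f([e_j, e_i]) f_i f_j`. -/
def koszulGen : Module.Dual k L →ₗ[k] SuperExterior k L :=
  ∑ i, ∑ j, LinearMap.toSpanSingleton k (SuperExterior k L)
      ((2 : k)⁻¹ • (gen k ((homBasis k L).coord i) * gen k ((homBasis k L).coord j))) ∘ₗ
    (Module.Dual.eval k L (superBracket k (homBasis k L j) (homBasis k L i)))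

lemma koszulGen_apply (f : Module.Dual k L) : koszulGen f =
    ∑ i, ∑ j, f (superBracket k (homBasis k L j) (homBasis k L i)) • ((2 : k)⁻¹ •
      (gen k ((homBasis k L).coord i) * gen k ((homBasis k L).coord j))) := by
  simp [koszulGen]

lemma koszulGen_swap (a b : ZMod 2) {f h : Module.Dual k L} (hf : f ∈ superPart k a)
    (hh : h ∈ superPart k b) : koszulGen f * gen k h = superSign a b • (gen k h * koszulGen f) := by
  rw [koszulGen_apply, Finset.sum_mul, Finset.mul_sum, Finset.smul_sum]
  refine Finset.sum_congr rfl fun i _ => ?_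
  rw [Finset.sum_mul, Finset.mul_sum, Finset.smul_sum]
  refine Finset.sum_congr rfl fun j _ => ?_
  by_cases hc : a + (basisParity j + basisParity i) = 0
  · simp only [smul_mul_assoc, mul_smul_comm]
    rw [smul_comm (superSign a b), smul_comm (superSign a b)]
    congr 2
    rw [mul_assoc, gen_swap _ _ (coord_mem j) hh, mul_neg, mul_smul_comm, ← mul_assoc,
      gen_swap _ _ (coord_mem i) hh, neg_mul, smul_mul_assoc, smul_neg, neg_neg, smul_smul,
      mul_assoc]
    congr 1
    clear hf hh
    revert hc
    generalize basisParity i = c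
    generalize basisParity j = d
    revert a b c d
    decide
  · have h0 : f (superBracket k (homBasis k L j) (homBasis k L i)) = 0 :=
      eq_zero_of_mem_part_field (hf _ _ (LieSuperalgebra.bracket_mem _ _ _ _ (homBasis_mem j)
        (homBasis_mem i))) hc
    simp [h0]

/-- Auxiliary: the algebra homomorphism `z ↦ [[(-1)^{deg z} z, ∂ z], [0, z]]`, which encodes the
antiderivation `∂`. -/
def koszulMatrix : SuperExterior k L →ₐ[k] Matrix (Fin 2) (Fin 2) (SuperExterior k L) :=
  lift
    { toFun := fun f => !![-gen k f, koszulGen f; 0, gen k f]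
      map_add' := fun f h => by
        ext i j; fin_cases i <;> fin_cases j <;> simp [add_comm]
      map_smul' := fun c f => by
        ext i j; fin_cases i <;> fin_cases j <;> simp }
    (fun a b f h hf hh => by
      have e1 := gen_swap a b hf hh
      have e2 := koszulGen_swap a b hf hh
      have e3 : koszulGen h * gen k f = superSign a b • (gen k f * koszulGen h) := by
        rw [koszulGen_swap b a hh hf]
        congr 1
        clear hf hh e1 e2
        revert a b; decide
      have e4 : superSign a b • (superSign a b • (gen k f * koszulGen h))
          = gen k f * koszulGen h := by
        rw [smul_smul]
        have : superSign a b * superSign a b = 1 := by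
          clear hf hh e1 e2 e3
          revert a b; decide
        rw [this, one_smul]
      ext i j
      fin_cases i <;> fin_cases j
      · simpa [Matrix.mul_apply, -zsmul_eq_mul] using e1
      · simp [Matrix.mul_apply, -zsmul_eq_mul, e2, e3, smul_add, e4]
      · simp [Matrix.mul_apply, -zsmul_eq_mul]
      · simpa [Matrix.mul_apply, -zsmul_eq_mul] using e1)

lemma koszulMatrix_gen (f : Module.Dual k L) :
    koszulMatrix (gen k f) = !![-gen k f, koszulGen f; 0, gen k f] :=
  lift_gen _ _ f

/-- The Koszul differential on `Λ_s(L^*)`: the antiderivation that extends `koszulGen`. -/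
def koszulD : SuperExterior k L →ₗ[k] SuperExterior k L :=
  Matrix.entryLinearMap k (SuperExterior k L) 0 1 ∘ₗ koszulMatrix.toLinearMap

lemma koszulMatrix_apply (z : SuperExterior k L) :
    koszulMatrix z = !![gradeInv z, koszulD z; 0, z] := by
  have h : koszulMatrix z 0 0 = gradeInv z ∧ koszulMatrix z 1 0 = 0 ∧ koszulMatrix z 1 1 = z := by
    induction z using SuperExterior.induction with
    | hs c => simp [Matrix.algebraMap_matrix_apply]
    | hg f => simp [koszulMatrix_gen]
    | hm x y hx hy => simp [Matrix.mul_apply, hx, hy]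
    | ha x y hx hy => simp [hx, hy]
  ext i j
  fin_cases i <;> fin_cases j <;> simp [h, koszulD]

lemma koszulD_gen (f : Module.Dual k L) : koszulD (gen k f) = koszulGen f := by
  simp [koszulD, koszulMatrix_gen]

lemma koszulD_algebraMap (c : k) : koszulD (algebraMap k (SuperExterior k L) c) = 0 := by
  simp [koszulD, Matrix.algebraMap_matrix_apply]

lemma koszulD_one : koszulD (1 : SuperExterior k L) = 0 := by
  simpa using koszulD_algebraMap (L := L) (1 : k)

lemma koszulD_mul (x y : SuperExterior k L) :
    koszulD (x * y) = koszulD x * y + gradeInv x * koszulD y := by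
  have := congr_fun (congr_fun (map_mul koszulMatrix x y) 0) 1
  simp only [koszulMatrix_apply, Matrix.mul_apply] at this
  simpa [add_comm] using this

lemma koszulD_gradeInv (x : SuperExterior k L) : koszulD (gradeInv x) = -gradeInv (koszulD x) := by
  induction x using SuperExterior.induction with
  | hs c => simp [koszulD_algebraMap]
  | hg f =>
    have : gradeInv (koszulGen f) = koszulGen f := by
      simp [koszulGen_apply]
    simp [koszulD_gen, this]
  | hm x y hx hy => simp [koszulD_mul, hx, hy]; abel
  | ha x y hx hy => simp [hx, hy]; abel

/-! ### The cohomology ring `H^•(L, k)` -/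

variable (k L)

/-- The cocycles of the Koszul complex `C(L, k) = Λ_s(L^*)`. -/
def cocycles : Subalgebra k (SuperExterior k L) where
  carrier := {z | koszulD z = 0}
  mul_mem' {x y} hx hy := by
    rw [Set.mem_ofPred_eq] at *
    rw [koszulD_mul, hx, hy, zero_mul, mul_zero, add_zero]
  add_mem' {x y} hx hy := by
    rw [Set.mem_ofPred_eq] at *
    rw [map_add, hx, hy, add_zero]
  algebraMap_mem' c := koszulD_algebraMap c

/-- The ring of cocycles of the Koszul complex `C(L, k)`. -/
def CocycleRing : Type _ := cocycles k L

instance : Ring (CocycleRing k L) := inferInstanceAs (Ring (cocycles k L))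

/-- The inclusion of the cocycles in `Λ_s(L^*)`. -/
def cocycleIncl : CocycleRing k L →+* SuperExterior k L := (cocycles k L).val.toRingHom

variable {k L} in
lemma koszulD_cocycleIncl (z : CocycleRing k L) : koszulD (cocycleIncl k L z) = 0 := z.2

/-- The ideal of coboundaries in the ring of cocycles. -/
def coboundaries : Ideal (CocycleRing k L) where
  carrier := {z | ∃ w, koszulD w = cocycleIncl k L z}
  add_mem' := by
    rintro x y ⟨v, hv⟩ ⟨w, hw⟩
    exact ⟨v + w, by rw [map_add, hv, hw, map_add]⟩
  zero_mem' := ⟨0, by rw [map_zero, map_zero]⟩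
  smul_mem' := by
    rintro z x ⟨w, hw⟩
    refine ⟨gradeInv (cocycleIncl k L z) * w, ?_⟩
    rw [koszulD_mul, koszulD_gradeInv, koszulD_cocycleIncl, map_zero, neg_zero, zero_mul, zero_add,
      gradeInv_gradeInv, hw, smul_eq_mul, map_mul]

instance : (coboundaries k L).IsTwoSided where
  mul_mem_of_left := by
    rintro x z ⟨w, hw⟩
    refine ⟨w * cocycleIncl k L z, ?_⟩
    rw [koszulD_mul, koszulD_cocycleIncl, mul_zero, add_zero, hw, map_mul]

/-- The cohomology ring `H^•(L, k)`, the cohomology of the Koszul complex `C(L, k)`. -/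
abbrev CohomologyRing : Type _ := CocycleRing k L ⧸ coboundaries k L

/-! ### Cohomology with coefficients -/

variable (V : Type*) [AddCommGroup V] [Module k V] [Superspace k V] [LieSupermodule k L V]

open scoped TensorProduct

/-- The space `C(L, V) = Λ_s(L^*) ⊗ V` of cochains with coefficients in `V`. -/
def KoszulComplex : Type _ := SuperExterior k L ⊗[k] V

instance : AddCommGroup (KoszulComplex k L V) :=
  inferInstanceAs (AddCommGroup (SuperExterior k L ⊗[k] V))

instance : Module k (KoszulComplex k L V) :=
  inferInstanceAs (Module k (SuperExterior k L ⊗[k] V))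

instance : Module (SuperExterior k L) (KoszulComplex k L V) :=
  inferInstanceAs (Module (SuperExterior k L) (SuperExterior k L ⊗[k] V))

/-- The Koszul differential on `C(L, V) = Λ_s(L^*) ⊗ V`. With a basis `e_i` of `L` and the dual
basis `f_i` it is `∂(z ⊗ v) = ∂ z ⊗ v + (-1)^{deg z} ∑_i z f_i ⊗ e_i.v`. -/
def koszulDV : KoszulComplex k L V →ₗ[k] KoszulComplex k L V :=
  (TensorProduct.map koszulD LinearMap.id +
    ∑ i, TensorProduct.map
      (LinearMap.mulRight k (gen k ((homBasis k L).coord i)) ∘ₗ gradeInv.toLinearMap)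
      (superAct k (homBasis k L i)) :
    SuperExterior k L ⊗[k] V →ₗ[k] SuperExterior k L ⊗[k] V)

lemma koszulDV_tmul (z : SuperExterior k L) (v : V) :
    koszulDV k L V (z ⊗ₜ[k] v : SuperExterior k L ⊗[k] V) =
      (koszulD z ⊗ₜ[k] v + ∑ i, (gradeInv z * gen k ((homBasis k L).coord i)) ⊗ₜ[k]
        (superAct k (homBasis k L i) v) : SuperExterior k L ⊗[k] V) := by
  change (TensorProduct.map koszulD LinearMap.id +
    ∑ i, TensorProduct.map
      (LinearMap.mulRight k (gen k ((homBasis k L).coord i)) ∘ₗ gradeInv.toLinearMap)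
      (superAct k (homBasis k L i)) :
    SuperExterior k L ⊗[k] V →ₗ[k] SuperExterior k L ⊗[k] V) _ = _
  simp [-Fintype.sum_sum_type]

lemma koszulDV_smul (z : SuperExterior k L) (ξ : KoszulComplex k L V) :
    koszulDV k L V (z • ξ) = koszulD z • ξ + gradeInv z • koszulDV k L V ξ := by
  refine TensorProduct.induction_on (motive := fun ξ : SuperExterior k L ⊗[k] V =>
    koszulDV k L V (z • (show KoszulComplex k L V from ξ)) =
      koszulD z • (show KoszulComplex k L V from ξ) + gradeInv z • koszulDV k L V ξ) ξ ?_ ?_ ?_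
  · change koszulDV k L V (z • (0 : KoszulComplex k L V)) = koszulD z • (0 : KoszulComplex k L V)
      + gradeInv z • koszulDV k L V (0 : KoszulComplex k L V)
    rw [map_zero, smul_zero, smul_zero, smul_zero, map_zero, add_zero]
  · intro w v
    rw [koszulDV_tmul]
    change koszulDV k L V (z • (w ⊗ₜ[k] v) : SuperExterior k L ⊗[k] V) = ((koszulD z • (w ⊗ₜ[k] v) +
      gradeInv z • (koszulD w ⊗ₜ[k] v + ∑ i, (gradeInv w * gen k ((homBasis k L).coord i)) ⊗ₜ[k]
        (superAct k (homBasis k L i) v))) : SuperExterior k L ⊗[k] V)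
    rw [TensorProduct.smul_tmul', koszulDV_tmul]
    simp only [TensorProduct.smul_tmul', smul_eq_mul, koszulD_mul, map_mul,
      smul_add, Finset.smul_sum, TensorProduct.add_tmul, mul_assoc, add_assoc]
    rfl
  · intro x y hx hy
    have e : ∀ a : SuperExterior k L, a • (show KoszulComplex k L V from x + y) =
        a • (show KoszulComplex k L V from x) + a • (show KoszulComplex k L V from y) :=
      fun a => smul_add (A := KoszulComplex k L V) a x y
    have e' : koszulDV k L V (x + y) = koszulDV k L V x + koszulDV k L V y :=
      (koszulDV k L V).map_add x y
    rw [e, e, e', map_add, smul_add, hx, hy]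
    abel

/-- `C(L, V)` is a left module over the cocycles in `C(L, k)`. -/
instance koszulModule : Module (CocycleRing k L) (KoszulComplex k L V) :=
  Module.compHom _ (cocycleIncl k L)

lemma cocycle_smul (z : CocycleRing k L) (ξ : KoszulComplex k L V) :
    z • ξ = cocycleIncl k L z • ξ := rfl

/-- The cocycles in `C(L, V)`, as a left module over the cocycles in `C(L, k)`. -/
def cocyclesV : Submodule (CocycleRing k L) (KoszulComplex k L V) where
  carrier := {ξ | koszulDV k L V ξ = 0}
  add_mem' {x y} hx hy := by
    rw [Set.mem_ofPred_eq] at *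
    rw [map_add, hx, hy, add_zero]
  zero_mem' := map_zero _
  smul_mem' := by
    intro z ξ hξ
    rw [Set.mem_ofPred_eq] at *
    rw [cocycle_smul, koszulDV_smul, koszulD_cocycleIncl, hξ, zero_smul, smul_zero, add_zero]

variable {k L V} in
lemma koszulDV_coe (ξ : cocyclesV k L V) : koszulDV k L V ξ = 0 := ξ.2

/-- The coboundaries in `C(L, V)`. -/
def coboundariesV : Submodule (CocycleRing k L) (cocyclesV k L V) where
  carrier := {ξ | ∃ η, koszulDV k L V η = (ξ : KoszulComplex k L V)}
  add_mem' := by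
    rintro x y ⟨v, hv⟩ ⟨w, hw⟩
    exact ⟨v + w, by rw [map_add, hv, hw]; rfl⟩
  zero_mem' := ⟨0, map_zero _⟩
  smul_mem' := by
    rintro z ξ ⟨η, hη⟩
    refine ⟨gradeInv (cocycleIncl k L z) • η, ?_⟩
    rw [koszulDV_smul, koszulD_gradeInv, koszulD_cocycleIncl, map_zero, neg_zero, zero_smul,
      zero_add, gradeInv_gradeInv, hη]
    rfl

/-- The cohomology `H^•(L, V)`, the cohomology of the Koszul complex `C(L, V)`. -/
abbrev Cohomology : Type _ := cocyclesV k L V ⧸ coboundariesV k L V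

lemma cohomology_isTorsionBySet :
    Module.IsTorsionBySet (CocycleRing k L) (Cohomology k L V) (coboundaries k L) := by
  rintro ξ ⟨z, w, hw⟩
  obtain ⟨ξ, rfl⟩ := Submodule.Quotient.mk_surjective _ ξ
  change z • Submodule.Quotient.mk (p := coboundariesV k L V) ξ = 0
  rw [← Submodule.Quotient.mk_smul, Submodule.Quotient.mk_eq_zero]
  refine ⟨w • (ξ : KoszulComplex k L V), ?_⟩
  rw [koszulDV_smul, koszulDV_coe, smul_zero, add_zero, hw]
  rfl

/-- The left cup product action of `H^•(L, k)` on `H^•(L, V)`. -/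
instance cohomologyModule : Module (CohomologyRing k L) (Cohomology k L V) :=
  (cohomology_isTorsionBySet k L V).module

/-! ### Support varieties -/

variable (M N : Type*) [AddCommGroup M] [Module k M] [Superspace k M] [LieSupermodule k L M]
  [AddCommGroup N] [Module k N] [Superspace k N] [LieSupermodule k L N]

/-- `Ext_L^•(M, N) = H^•(L, Hom_k(M, N))`, computed by the Koszul complex. -/
abbrev SuperExt : Type _ := Cohomology k L (M →ₗ[k] N)

/-- The annihilator `I_L(M, N)` of the cup product action of `H^•(L, k)` on `Ext_L^•(M, N)`. -/
def extAnnihilator : Ideal (CohomologyRing k L) :=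
  Module.annihilator (CohomologyRing k L) (SuperExt k L M N)

instance : (extAnnihilator k L M N).IsTwoSided :=
  inferInstanceAs (Module.annihilator (CohomologyRing k L) (SuperExt k L M N)).IsTwoSided

/-! ### The map `φ` -/

/-- The symmetric algebra `S(L_1^*)` on the dual of the odd part of `L`. -/
abbrev OddSym : Type _ := SymmetricAlgebra k (Module.Dual k (superPart k (V := L) 1))

variable {k L}

/-- The inclusion `L_1^* → L^*`, extension by zero on `L_0`. -/
def oddDual : Module.Dual k (superPart k (V := L) 1) →ₗ[k] Module.Dual k L :=
  (Submodule.projectionOnto (superPart k (V := L) 1) (superPart k 0)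
    Superspace.isCompl.symm).dualMap

lemma oddDual_mem (f : Module.Dual k (superPart k (V := L) 1)) :
    oddDual f ∈ superPart k (V := Module.Dual k L) 1 := by
  intro b v hv
  refine mem_part_field fun h => ?_
  rcases zmod_two_cases b with rfl | rfl
  · simp [oddDual, Submodule.projectionOnto_apply_of_mem_right _ hv]
  · exact absurd (CharTwo.add_self_eq_zero (1 : ZMod 2)) h

/-- The inclusion `S(L_1^*) → Λ_s(L^*)`. -/
def symIncl : OddSym k L →ₐ[k] SuperExterior k L :=
  RingCon.liftₐ (TensorAlgebra.symRingCon k _)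
    (TensorAlgebra.lift k ((gen k : Module.Dual k L →ₗ[k] SuperExterior k L) ∘ₗ oddDual))
    (RingCon.ringConGen_le.2 fun x y h => by
      induction h with
      | mul_comm f h =>
        have := gen_swap 1 1 (oddDual_mem f) (oddDual_mem h)
        simpa [RingCon.ker_apply, superSign, ZMod.val_one] using this)

lemma symIncl_ι (f : Module.Dual k (superPart k (V := L) 1)) :
    symIncl (SymmetricAlgebra.ι k _ f) = gen k (oddDual f) :=
  (RingCon.liftₐ_mk _ _ _ _).trans (TensorAlgebra.lift_ι_apply _ _)

instance charP_oddSym (p : ℕ) [CharP k p] : CharP (OddSym k L) p :=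
  charP_of_injective_algebraMap (SymmetricAlgebra.algebraMap_leftInverse _).injective p

lemma koszulD_pow_succ {y : SuperExterior k L} (hy : gradeInv y = -y)
    (h : koszulD y * y = -(y * koszulD y)) (n : ℕ) :
    koszulD (y ^ (n + 1)) = (n + 1) • (koszulD y * y ^ n) := by
  induction n with
  | zero => simp
  | succ n ih =>
    have e : y * (koszulD y * y ^ n) = -(koszulD y * y ^ (n + 1)) := by
      rw [← mul_assoc, ← neg_neg (y * koszulD y), ← h, neg_mul, mul_assoc, ← pow_succ']
    rw [pow_succ' y (n + 1), koszulD_mul, ih, hy, neg_mul, mul_smul_comm, e, smul_neg, neg_neg,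
      succ_nsmul _ (n + 1), add_comm]

lemma koszulD_symIncl_pow (p : ℕ) [hp : Fact p.Prime] [CharP k p] (z : OddSym k L) :
    koszulD (symIncl (z ^ p)) = 0 := by
  induction z using SymmetricAlgebra.induction with
  | algebraMap c => rw [← map_pow, AlgHom.commutes, koszulD_algebraMap]
  | ι f =>
    obtain ⟨n, rfl⟩ : ∃ n, p = n + 1 := ⟨p - 1, (Nat.sub_add_cancel hp.out.one_le).symm⟩
    have hsw : koszulD (gen k (oddDual f)) * gen k (oddDual f)
        = -(gen k (oddDual f) * koszulD (gen k (oddDual f))) := by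
      rw [koszulD_gen, koszulGen_swap 1 1 (oddDual_mem f) (oddDual_mem f)]
      simp [superSign, ZMod.val_one]
    rw [map_pow, symIncl_ι, koszulD_pow_succ (gradeInv_gen _) hsw, ← Nat.cast_smul_eq_nsmul k,
      CharP.cast_eq_zero, zero_smul]
  | mul a b ha hb => rw [mul_pow, map_mul, koszulD_mul, ha, hb, zero_mul, mul_zero, add_zero]
  | add a b ha hb =>
    rw [← frobenius_def, map_add, map_add, map_add, frobenius_def, frobenius_def, ha, hb, add_zero]

variable (k L)

/-- The `p`-power map `z ↦ z^p`, from `S(L_1^*)` to the cocycles of `Λ_s(L^*)`. -/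
def powCocycle (p : ℕ) [Fact p.Prime] [CharP k p] : OddSym k L →+* CocycleRing k L :=
  (symIncl.toRingHom.comp (frobenius (OddSym k L) p)).codRestrict (cocycles k L)
    fun z => koszulD_symIncl_pow p z

/-- The homomorphism `φ : S(L_1^*[p])^{(1)} → H^•(L, k)` that sends `z` to the class of `z^p`.
The Frobenius twist and the regrading change only the `k`-module structure and the grading of the
source, but not the underlying ring, which is all that matters for the spectra below. -/
def phi (p : ℕ) [Fact p.Prime] [CharP k p] : OddSym k L →+* CohomologyRing k L :=
  (Ideal.Quotient.mk (coboundaries k L)).comp (powCocycle k L p)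

/-- The ideal `J_L(M, N) = φ⁻¹(I_L(M, N))`. -/
def phiIdeal (p : ℕ) [Fact p.Prime] [CharP k p] : Ideal (OddSym k L) :=
  (extAnnihilator k L M N).comap (phi k L p)

/-- The homomorphism `φ_{M,N} : S(L_1^*[p])^{(1)} / J_L(M, N) → H^•(L, k) / I_L(M, N)` that is
induced by `φ`. -/
def phiQuot (p : ℕ) [Fact p.Prime] [CharP k p] :
    OddSym k L ⧸ phiIdeal k L M N p →+* CohomologyRing k L ⧸ extAnnihilator k L M N :=
  Ideal.quotientMap (extAnnihilator k L M N) (phi k L p) le_rfl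

end Koszul

/-- The maximal ideal spectrum of a graded-commutative superalgebra `A`, that is, the maximal ideal
spectrum of the commutative ring `A / Nil(A)`, where `Nil(A)` is the ideal of all nilpotent
elements. Ideals of `A / Nil(A)` are given as ideals of `A` that contain `Nil(A)`. -/
@[ext]
structure SuperMax (A : Type*) [Ring A] where
  asIdeal : Ideal A
  isMaximal : asIdeal.IsMaximal
  nil_mem : ∀ x : A, IsNilpotent x → x ∈ asIdeal

/-- The Zariski topology, with the basic open sets `{m | a ∉ m}`. -/
instance superMaxTopology (A : Type*) [Ring A] : TopologicalSpace (SuperMax A) :=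
  TopologicalSpace.generateFrom {U | ∃ a : A, U = {m | a ∉ m.asIdeal}}

section Varieties

variable (k L : Type*) [Field k] [AddCommGroup L] [Module k L] [Superspace k L]
  [FiniteDimensional k L] [LieSuperalgebra k L]
  (M N : Type*) [AddCommGroup M] [Module k M] [Superspace k M] [LieSupermodule k L M]
  [AddCommGroup N] [Module k N] [Superspace k N] [LieSupermodule k L N]

/-- The relative support variety `|U(L)|_{(M,N)} = Max(H^•(L, k) / I_L(M, N))`. -/
abbrev SupportVariety : Type _ := SuperMax (CohomologyRing k L ⧸ extAnnihilator k L M N)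

/-- The variety `𝒳_L(M, N) = Max(S(L_1^*[p])^{(1)} / J_L(M, N))`. The ring is commutative, so this
is the usual maximal ideal spectrum with the Zariski topology. -/
abbrev XVariety (p : ℕ) [Fact p.Prime] [CharP k p] : Type _ :=
  MaximalSpectrum (OddSym k L ⧸ phiIdeal k L M N p)

end Varieties

end

/-! The generators of `Λ_s(L^*)` dual to the even part anticommute with every generator and square
to zero, so they generate a nil ideal, and killing them leaves the commutative ring `S(L_1^*)`.
Every cocycle `z` is therefore determined up to nilpotents by its projection `s` to `S(L_1^*)`. The
cocycles `z ^ p` and `s ^ p` have the same projection, and the class of `s ^ p` is `φ(s)`. Hence,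
modulo a nil ideal, the target of `φ_{M,N}` is commutative and each of its `p`-th powers comes from
the source. As `φ_{M,N}` is injective by the choice of `J`, it is an integral map up to nilpotents,
bijective on maximal ideals, and basic open sets correspond because an element and its `p`-th power
lie in the same prime ideals. The nilpotence is `isNilpotent_of_symProj_eq_zero`. It is proved on
cochains and passed on to quotients of the cocycle ring by `exists_commRing_quotient`, so no
cohomology has to be computed. The statement about spectra is `exists_homeomorph_superMax`. -/

/-! ### Maximal spectra and maps through which all `n`-th powers factor -/

section MaximalSpectra

variable {A B C : Type*} [CommRing A] [Ring B] [CommRing C]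

/-- Let `f : A → B` be injective, and let `π` be a surjection with nil kernel from `B` to a
commutative ring in which every `n`-th power comes from `A`. Then `m ↦ f⁻¹(m)` is a homeomorphism
of maximal ideal spectra. -/
theorem exists_homeomorph_superMax (f : A →+* B) (hf : Function.Injective f) (π : B →+* C)
    (hπ : Function.Surjective π) (hker : ∀ b, π b = 0 → IsNilpotent b) {n : ℕ} (hn : n ≠ 0)
    (hpow : ∀ b, ∃ a, π b ^ n = π (f a)) :
    ∃ Φ : SuperMax B ≃ₜ MaximalSpectrum A, ∀ m, (Φ m).asIdeal = m.asIdeal.comap f := by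
  have hint : (π.comp f).IsIntegral := fun c => by
    obtain ⟨b, rfl⟩ := hπ c
    obtain ⟨a, ha⟩ := hpow b
    let _ := (π.comp f).toAlgebra
    have : IsIntegral A (π b ^ n) := by
      rw [ha]
      exact isIntegral_algebraMap (R := A) (A := C) (x := a)
    exact this.of_pow (Nat.pos_of_ne_zero hn)
  -- Points of `SuperMax B` contain the nil ideal `ker π`, so they correspond to maximal ideals of
  -- the commutative ring `C`, where maximal ideals are prime.
  have hle (m : SuperMax B) : RingHom.ker π ≤ m.asIdeal := fun b hb => m.nil_mem b (hker b hb)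
  have hmap (m : SuperMax B) : (m.asIdeal.map π).IsMaximal :=
    have := m.isMaximal
    Ideal.IsMaximal.map_of_surjective_of_ker_le hπ (hle m)
  have hmem (m : SuperMax B) (b : B) : π b ∈ m.asIdeal.map π ↔ b ∈ m.asIdeal := by
    rw [← Ideal.mem_comap, Ideal.comap_map_of_surjective' π hπ, sup_eq_left.2 (hle m)]
  -- Primality in `C` lets `b` be traded for an element of `A`. Both injectivity and the comparison
  -- of topologies rest on this.
  have hiff (m : SuperMax B) (a : A) (b : B) (h : π b ^ n = π (f a)) :
      b ∈ m.asIdeal ↔ f a ∈ m.asIdeal := by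
    rw [← hmem, ← hmem m (f a), ← h]
    exact ((hmap m).isPrime.pow_mem_iff_mem _ (Nat.pos_of_ne_zero hn)).symm
  have hcomap (m : SuperMax B) : (m.asIdeal.comap f).IsMaximal := by
    have e : m.asIdeal.comap f = (m.asIdeal.map π).comap (π.comp f) := by
      ext a
      rw [Ideal.mem_comap, Ideal.mem_comap, RingHom.comp_apply, hmem]
    rw [e]
    have := hmap m
    exact Ideal.isMaximal_comap_of_isIntegral_of_isMaximal' _ hint _
  let F : SuperMax B → MaximalSpectrum A := fun m => ⟨m.asIdeal.comap f, hcomap m⟩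
  have hinj : Function.Injective F := by
    intro m m' h
    have h' : ∀ a, f a ∈ m.asIdeal ↔ f a ∈ m'.asIdeal := fun a =>
      SetLike.ext_iff.1 (congrArg MaximalSpectrum.asIdeal h) a
    ext b
    obtain ⟨a, ha⟩ := hpow b
    rw [hiff m a b ha, hiff m' a b ha, h']
  have hsurj : Function.Surjective F := by
    intro m
    let := (π.comp f).toAlgebra
    have : Algebra.IsIntegral A C := ⟨hint⟩
    -- Lying over needs this inclusion. An element killed in `C` has nilpotent image in `B`, hence
    -- is nilpotent in `A` by injectivity of `f`.
    have hk : RingHom.ker (algebraMap A C) ≤ m.asIdeal := by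
      intro a ha
      obtain ⟨r, hr⟩ := hker (f a) ha
      have : a ^ r = 0 := hf (by rw [map_pow, hr, map_zero])
      exact m.isMaximal.isPrime.mem_of_pow_mem r (this ▸ zero_mem _)
    have := m.isMaximal
    obtain ⟨Q, hQ, hQm⟩ := Ideal.exists_ideal_over_maximal_of_isIntegral m.asIdeal hk
    refine ⟨⟨Q.comap π, Ideal.comap_isMaximal_of_surjective π hπ, ?_⟩, ?_⟩
    · rintro b ⟨r, hr⟩
      refine hQ.isPrime.mem_of_pow_mem r ?_
      rw [← map_pow, hr, map_zero]
      exact zero_mem _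
    · exact MaximalSpectrum.ext (by rw [← hQm]; rfl)
  -- The topology on `MaximalSpectrum A` is induced from the prime spectrum, so the basic open sets
  -- restrict to a basis.
  have hbasis : TopologicalSpace.IsTopologicalBasis
      (Set.range fun a : A => {m : MaximalSpectrum A | a ∉ m.asIdeal}) := by
    have := PrimeSpectrum.isTopologicalBasis_basic_opens (R := A)
      |>.induced (MaximalSpectrum.toPrimeSpectrum (R := A))
    rw [← Set.range_comp] at this
    exact this
  -- The two generating families coincide: the set of `b` is the preimage of the set of any `a` with
  -- `π b ^ n = π (f a)`, and the preimage of the set of `a` is the set of `f a`. A bijection that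
  -- induces the topology is a homeomorphism.
  have hind : superMaxTopology B = MaximalSpectrum.zariskiTopology.induced F := by
    rw [hbasis.eq_generateFrom, induced_generateFrom_eq]
    change TopologicalSpace.generateFrom _ = _
    congr 1
    ext U
    simp only [Set.mem_ofPred_eq, Set.mem_image, Set.mem_range]
    constructor
    · rintro ⟨b, rfl⟩
      obtain ⟨a, ha⟩ := hpow b
      refine ⟨_, ⟨a, rfl⟩, ?_⟩
      ext m
      exact not_congr (hiff m a b ha).symm
    · rintro ⟨_, ⟨a, rfl⟩, rfl⟩
      exact ⟨f a, rfl⟩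
  exact ⟨(Equiv.ofBijective F ⟨hinj, hsurj⟩).toHomeomorphOfIsInducing ⟨hind⟩, fun m => rfl⟩

end MaximalSpectra

/-! ### Nilpotence of the kernel of `Λ_s(L^*) → S(L_1^*)` -/

section NilpotentKernel

/-- A finite sum of left multiples of elements `e` with `e R e = 0` and `e R ⊆ R e` is nilpotent. -/
lemma isNilpotent_of_mem_span {R : Type*} [Ring R] (T : Finset R)
    (h0 : ∀ e ∈ T, ∀ x, e * x * e = 0) (h1 : ∀ e ∈ T, ∀ x, ∃ y, e * x = y * e) {z : R}
    (hz : z ∈ Ideal.span (T : Set R)) : IsNilpotent z := by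
  classical
  induction T using Finset.induction_on generalizing z with
  | empty => simp_all
  | insert e T he ih =>
    rw [Finset.coe_insert, Ideal.span_insert, Submodule.mem_sup] at hz
    obtain ⟨a, ha, b, hb, rfl⟩ := hz
    obtain ⟨m, hm⟩ := ih (fun e he => h0 e (Finset.mem_insert_of_mem he))
      (fun e he => h1 e (Finset.mem_insert_of_mem he)) hb
    -- The left ideal `R e` is two-sided because `e R ⊆ R e`, and `a` is zero modulo it.
    have key : ∀ r : ℕ, (a + b) ^ r - b ^ r ∈ Ideal.span {e} := by
      intro r
      induction r with
      | zero => simp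
      | succ r ihr =>
        have e1 : (a + b) ^ (r + 1) - b ^ (r + 1)
            = (a + b) * ((a + b) ^ r - b ^ r) + a * b ^ r := by
          rw [pow_succ', pow_succ']; noncomm_ring
        rw [e1]
        refine add_mem (Ideal.mul_mem_left _ _ ihr) ?_
        obtain ⟨x, rfl⟩ := Ideal.mem_span_singleton'.1 ha
        obtain ⟨y, hy⟩ := h1 e (Finset.mem_insert_self e T) (b ^ r)
        exact Ideal.mem_span_singleton'.2 ⟨x * y, by rw [mul_assoc, ← hy, mul_assoc]⟩
    have hm' := key m
    rw [hm, sub_zero] at hm'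
    obtain ⟨x, hx⟩ := Ideal.mem_span_singleton'.1 hm'
    -- Since `b ^ m = 0`, the power `(a + b) ^ m` has the form `x * e`, and its square contains the
    -- factor `e * x * e = 0`.
    refine ⟨m * 2, ?_⟩
    rw [pow_mul, ← hx, pow_two, mul_assoc, ← mul_assoc e,
      h0 e (Finset.mem_insert_self e T), mul_zero]

variable {k L : Type*} [Field k] [AddCommGroup L] [Module k L] [Superspace k L]

open SuperExterior

/-- An even functional has parity sign `1` against both parities, so only the cohomological sign
remains: it anticommutes with every generator, and moving it past `x` costs `(-1)^{deg x}`. -/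
lemma gen_even_mul {f : Module.Dual k L} (hf : f ∈ superPart k 0) (x : SuperExterior k L) :
    gen k f * x = gradeInv x * gen k f := by
  induction x using SuperExterior.induction with
  | hs c => rw [AlgHom.commutes, Algebra.commutes]
  | hg h =>
    have := gen_swap 0 0 hf (evenProj_mem h)
    have := gen_swap 0 1 hf (oddProj_mem h)
    rw [← evenProj_add_oddProj (k := k) h]
    simp_all [superSign, mul_add, add_mul]
  | hm x y hx hy => rw [← mul_assoc, hx, mul_assoc, hy, map_mul, mul_assoc]
  | ha x y hx hy => rw [mul_add, hx, hy, map_add, add_mul]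

/-- The generator anticommutes with itself, so twice its square vanishes. -/
lemma gen_even_mul_self (h2 : (2 : k) ≠ 0) {f : Module.Dual k L} (hf : f ∈ superPart k 0) :
    gen k f * gen k f = 0 := by
  have h := gen_even_mul hf (gen k f)
  rw [gradeInv_gen, neg_mul, eq_neg_iff_add_eq_zero, ← two_smul k] at h
  exact (smul_eq_zero.1 h).resolve_left h2

/-- The projection `Λ_s(L^*) → S(L_1^*)` that sends `L_0^*` to zero. -/
def symProj : SuperExterior k L →ₐ[k] OddSym k L :=
  SuperExterior.lift (SymmetricAlgebra.ι k _ ∘ₗ (superPart k (V := L) 1).subtype.dualMap)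
    (fun a b f h hf hh => by
      -- Even functionals vanish on the odd part, so a relation involving one becomes `0 = 0`.
      -- Between two odd functionals the two signs cancel, leaving commutativity.
      have aux : ∀ g : Module.Dual k L, g ∈ superPart k 0 →
          (superPart k (V := L) 1).subtype.dualMap g = 0 := fun g hg => by
        ext v
        exact eq_zero_of_mem_part_field (hg 1 v v.2) (by decide)
      rcases zmod_two_cases a with rfl | rfl
      · simp [aux f hf]
      rcases zmod_two_cases b with rfl | rfl
      · simp [aux h hh]
      · simp [superSign, ZMod.val_one, mul_comm])

lemma symProj_gen (f : Module.Dual k L) : symProj (gen k f)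
    = SymmetricAlgebra.ι k _ ((superPart k (V := L) 1).subtype.dualMap f) :=
  lift_gen _ _ f

variable [FiniteDimensional k L] [LieSuperalgebra k L]

/-- Extending a functional on the odd part by zero and restricting it again changes nothing, and
generators suffice. This splitting makes `p`-power cocycles recoverable from their projections. -/
lemma symProj_symIncl (s : OddSym k L) : symProj (symIncl s) = s := by
  induction s using SymmetricAlgebra.induction with
  | algebraMap c => simp
  | ι f =>
    rw [symIncl_ι, symProj_gen]
    congr 1
    ext v
    simp [oddDual]
  | mul a b ha hb => simp [ha, hb]
  | add a b ha hb => simp [ha, hb]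

lemma sub_oddDual_mem (f : Module.Dual k L) :
    f - oddDual ((superPart k (V := L) 1).subtype.dualMap f) ∈ superPart k 0 := by
  intro b v hv
  refine mem_part_field fun hb => ?_
  rcases zmod_two_cases b with rfl | rfl
  · exact absurd (add_zero 0) hb
  · simp [oddDual, Submodule.projectionOnto_apply_of_mem_left _ hv]

/-- On a generator the difference is the even component of the functional. Congruence modulo the
ideal is preserved by products because the left ideal is two-sided. -/
lemma sub_symIncl_symProj_mem (z : SuperExterior k L) : z - symIncl (symProj z) ∈
    Ideal.span (gen k '' (superPart k (V := Module.Dual k L) 0 : Set (Module.Dual k L))) := by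
  -- Two-sidedness comes from the sign rule for moving even generators to the right.
  have hr : ∀ x y : SuperExterior k L,
      x ∈ Ideal.span (gen k '' (superPart k (V := Module.Dual k L) 0 : Set (Module.Dual k L))) →
      x * y ∈
        Ideal.span (gen k '' (superPart k (V := Module.Dual k L) 0 : Set (Module.Dual k L))) := by
    intro x y hx
    induction hx using Submodule.span_induction with
    | mem x hx =>
      obtain ⟨f, hf, rfl⟩ := hx
      rw [gen_even_mul hf]
      exact Ideal.mul_mem_left _ _ (Ideal.subset_span ⟨f, hf, rfl⟩)
    | zero => rw [zero_mul]; exact zero_mem _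
    | add x x' _ _ hx hx' => rw [add_mul]; exact add_mem hx hx'
    | smul a x _ hx => rw [smul_mul_assoc]; exact Ideal.mul_mem_left _ _ hx
  induction z using SuperExterior.induction with
  | hs c => simp
  | hg f =>
    rw [symProj_gen, symIncl_ι, ← map_sub]
    exact Ideal.subset_span ⟨_, sub_oddDual_mem f, rfl⟩
  | hm x y hx hy =>
    have : x * y - symIncl (symProj (x * y)) = (x - symIncl (symProj x)) * y
        + symIncl (symProj x) * (y - symIncl (symProj y)) := by
      rw [map_mul, map_mul]; noncomm_ring
    rw [this]
    exact add_mem (hr _ _ hx) (Ideal.mul_mem_left _ _ hy)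
  | ha x y hx hy =>
    rw [map_add, map_add, add_sub_add_comm]
    exact add_mem hx hy

/-- Such a `z` is a combination of finitely many even generators `e`. Moving `e` across `x` turns `e
* x * e` into a multiple of `e * e = 0`, so the nilpotence criterion applies. -/
lemma isNilpotent_of_symProj_eq_zero (h2 : (2 : k) ≠ 0) {z : SuperExterior k L}
    (hz : symProj z = 0) : IsNilpotent z := by
  have h := sub_symIncl_symProj_mem z
  rw [hz, map_zero, sub_zero] at h
  obtain ⟨T, hT, hzT⟩ := Submodule.mem_span_finite_of_mem_span h
  refine isNilpotent_of_mem_span T (fun e he x => ?_) (fun e he x => ?_) hzT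
  · obtain ⟨f, hf, rfl⟩ := hT he
    rw [gen_even_mul hf, mul_assoc, gen_even_mul_self h2 hf, mul_zero]
  · obtain ⟨f, hf, rfl⟩ := hT he
    exact ⟨_, gen_even_mul hf x⟩

end NilpotentKernel

/-! ### Passing to a commutative quotient by a nil ideal -/

section Quotient

variable {Z B S : Type*} [Ring Z] [Ring B] [CommRing S]

/-- If `q : Z → B` is surjective and `π : Z → S` has nil kernel and commutative target, then `B`
has a commutative quotient by a nil ideal that identifies elements with the same image in `S`. -/
lemma exists_commRing_quotient (q : Z →+* B) (hq : Function.Surjective q) (π : Z →+* S)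
    (hπ : ∀ z, π z = 0 → IsNilpotent z) :
    ∃ (I : Ideal B) (_ : I.IsTwoSided), (∀ x y : B ⧸ I, x * y = y * x) ∧
      (∀ b ∈ I, IsNilpotent b) ∧ ∀ z w, π z = π w → q z - q w ∈ I := by
  -- The required ideal is the image of `ker π`. By surjectivity of `q` its members are exactly the
  -- images of kernel elements, so it inherits two-sidedness and nilpotence.
  have hmem (b : B) : b ∈ (RingHom.ker π).map q ↔ ∃ z, π z = 0 ∧ q z = b :=
    Ideal.mem_map_iff_of_surjective q hq
  have htwo : ((RingHom.ker π).map q).IsTwoSided := ⟨fun {b} c hb => by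
    obtain ⟨z, hz, rfl⟩ := (hmem b).1 hb
    obtain ⟨w, rfl⟩ := hq c
    exact (hmem _).2 ⟨z * w, by rw [map_mul, hz, zero_mul], map_mul _ _ _⟩⟩
  have hsub : ∀ z w, π z = π w → q z - q w ∈ (RingHom.ker π).map q := fun z w h =>
    (hmem _).2 ⟨z - w, by rw [map_sub, h, sub_self], map_sub _ _ _⟩
  refine ⟨_, htwo, fun x y => ?_, fun b hb => ?_, hsub⟩
  · obtain ⟨b, rfl⟩ := Ideal.Quotient.mk_surjective x
    obtain ⟨c, rfl⟩ := Ideal.Quotient.mk_surjective y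
    obtain ⟨z, rfl⟩ := hq b
    obtain ⟨w, rfl⟩ := hq c
    simp only [← map_mul]
    -- `z * w` and `w * z` have the same image in the commutative ring `S`.
    exact Ideal.Quotient.eq.2 (hsub _ _ (by rw [map_mul, map_mul, mul_comm]))
  · obtain ⟨z, hz, rfl⟩ := (hmem b).1 hb
    exact (hπ z hz).map q

end Quotient

/-! ### The homeomorphism of support varieties -/

theorem mainTheorem6 (k : Type*) [Field k] [IsAlgClosed k] (p : ℕ) [Fact p.Prime] [CharP k p]
    (hp : 3 ≤ p)
    (L : Type*) [AddCommGroup L] [Module k L] [FiniteDimensional k L] [Superspace k L]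
    [LieSuperalgebra k L]
    (M : Type*) [AddCommGroup M] [Module k M] [FiniteDimensional k M] [Superspace k M]
    [LieSupermodule k L M]
    (N : Type*) [AddCommGroup N] [Module k N] [FiniteDimensional k N] [Superspace k N]
    [LieSupermodule k L N] :
    ∃ Φ : SupportVariety k L M N ≃ₜ XVariety k L M N p,
      ∀ m : SupportVariety k L M N, (Φ m).asIdeal = m.asIdeal.comap (phiQuot k L M N p) := by
  have h2 : (2 : k) ≠ 0 := Ring.two_ne_zero (by rw [ringChar.eq k p]; omega)
  have hinj : Function.Injective (cocycleIncl k L) := Subtype.val_injective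
  let q : CocycleRing k L →+* CohomologyRing k L ⧸ extAnnihilator k L M N :=
    (Ideal.Quotient.mk _).comp (Ideal.Quotient.mk (coboundaries k L))
  have hq : Function.Surjective q :=
    Ideal.Quotient.mk_surjective.comp Ideal.Quotient.mk_surjective
  -- The projection is used on cocycles only. Coboundaries need not project to zero, and it is not
  -- required to descend to cohomology.
  let π : CocycleRing k L →+* OddSym k L := (symProj : _ →ₐ[k] _).toRingHom.comp (cocycleIncl k L)
  have hπ : ∀ z, π z = 0 → IsNilpotent z := fun z hz =>
    (IsNilpotent.map_iff hinj).1 (isNilpotent_of_symProj_eq_zero h2 hz)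
  obtain ⟨I, hI, hcomm, hnil, hsub⟩ := exists_commRing_quotient q hq π hπ
  let _ : CommRing ((CohomologyRing k L ⧸ extAnnihilator k L M N) ⧸ I) :=
    { (inferInstance : Ring ((CohomologyRing k L ⧸ extAnnihilator k L M N) ⧸ I)) with
      mul_comm := hcomm }
  -- Injectivity holds because `J` is the full preimage of the annihilator.
  refine exists_homeomorph_superMax (phiQuot k L M N p) Ideal.quotientMap_injective
    (Ideal.Quotient.mk I) Ideal.Quotient.mk_surjective
    (fun b hb => hnil b (Ideal.Quotient.eq_zero_iff_mem.1 hb)) (n := p)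
    (Fact.out : p.Prime).ne_zero fun b => ?_
  obtain ⟨z, rfl⟩ := hq b
  -- The witness is the class of the projection of `z`: its image under `φ_{M,N}` is represented by
  -- the cocycle `(π z) ^ p`, which projects to the same element as `z ^ p`.
  refine ⟨Ideal.Quotient.mk _ (π z), ?_⟩
  rw [← map_pow, ← map_pow]
  refine Ideal.Quotient.eq.2 (hsub _ (powCocycle k L p (π z)) ?_)
  rw [map_pow]
  exact (symProj_symIncl (π z ^ p)).symm
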